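/- **Model (TSO).** There are $n$ processes $i$, each with a local dispatcher $d_i$; processes and dispatchers are the *agents*. A state consists of a main memory (a value for each variable), a FIFO store buffer of pairs $\langle x,v\rangle$ for each process, and a local state for each process. The possible events are the following. * Process $i$ performs $\mathtt W(x,v)$: $\langle x,v\rangle$ is appended to its buffer. * Process $i$ reads $x$: from its buffer ($\mathtt{RfB}(x,v)$, where $v$ is the latest value for $x$ in the buffer) if the buffer holds an item for $x$, and otherwise from memory ($\mathtt{RfM}(x,v)$). * Process $i$ performs a fence $\mathtt F$ (enabled only if its buffer is empty), or $\mathtt{RMW}(x,v_{\exp},v_{\rm new})$ (enabled only if its buffer is empty and $x$ has value $v_{\exp}$ in memory; it sets $x$ to $v_{\rm new}$ in memory), or an internal action, or $\mathtt{return}(O)$, or the null action $\bot$. * Dispatcher $d_i$ performs $\mathtt{prop}(x,v)$ (the oldest item $\langle x,v\rangle$ of the buffer of $i$ is removed and written to memory), or $\bot$. $\mathtt{RfM}(x,\cdot)$, $\mathtt{RMW}(x,\cdot,\cdot)$ and $\mathtt{prop}(x,\cdot)$ are the *memory accesses* of $x$. Two memory accesses of the same variable by different agents *conflict* unless both are $\mathtt{RfM}$,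 or one is a $\mathtt{prop}$ of some $d_i$ and the other an $\mathtt{RfM}$ of the same $i$. The local state of a process is the list of its non-null events (a read is recorded as $\mathtt R(x,v)$, without its source) and of the invocations it received. A protocol $P$ assigns to each process and local state a nonempty set of actions. A *run* of $P$ is an infinite sequence $r(0),r(1),\dots$ of states, starting with empty buffers and empty local states, in which $r(t+1)$ results from $r(t)$ by one event (possibly $\bot$) of each agent, each enabled in $r(t)$ and pairwise non-conflicting, carried out in the order processes, then dispatchers, and by at most one invocation $\mathtt{invoke}(i,O)$ by the environment per process $i$; non-null actions of processes are taken from $P$, and a process is not invoked again before it has performed the matching return. The event that agent $b$ performs in the round from $t$ to $t+1$ is the event at the *node* $\langle b,t\rangle$. **Convention.** In all runs considered, an item is never read from the buffer of $i$ in the same round in which $d_i$ propagates it. **Occurs before.** $\overset{ob}\rightsquigarrow_r$ is the least transitive relation on nodes such that, for $t<t'$: 1. $\langle b,t\rangle\overset{ob}\rightsquigarrow_r\langle b,t'\rangle$ for every agent $b$; 2. $\langle i,t\rangle\overset{ob}\rightsquigarrow_r\langle d_i,t'\rangle$ if $i$ writes, or reads from its buffer, at $t$ the very item that $d_i$ propagates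 at $t'$; 3. $\langle b,t\rangle\overset{ob}\rightsquigarrow_r\langle c,t'\rangle$ if the events at both nodes are memory accesses of the same variable, except if both are $\mathtt{RfM}$, or if $b=d_i$, $c=i$ for some $i$, the first is a $\mathtt{prop}$ and the second an $\mathtt{RfM}$; 4. $\langle d_i,t\rangle\overset{ob}\rightsquigarrow_r\langle i,t'\rangle$ if the event at the first node is a $\mathtt{prop}$ and the one at the second is $\mathtt F$ or an $\mathtt{RMW}$. **Operations.** An operation $X$ of process $i$ occurs in $r$ between $X.s=\langle i,s\rangle$ and $X.e=\langle i,e\rangle$ if it is invoked in the round from $s$ to $s+1$ and its matching return is performed in the round from $e-1$ to $e$. It *contains a feedback loop* in $r$ if $X.s\overset{ob}\rightsquigarrow_r\langle b,t\rangle\overset{ob}\rightsquigarrow_r X.e$ for some node $\langle b,t\rangle$ with $b\notin\{i,d_i\}$. It *runs solo* in $r$ if no agent other than $i$ and $d_i$ performs a non-null action at a time $t$ with $s\le t\le e$. Runs $r,\tilde r$ are *locally equivalent*, $r\approx\tilde r$, if for every process the same local states appear in $r$ and in $\tilde r$. **Theorem.** Let $r$ be a run of a protocol $P$ and let $X$ be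 an operation that occurs in $r$ and contains no feedback loop in $r$. Then there is a run $\tilde r\approx r$ of $P$, with the same initial state as $r$, in which $X$ (the same invocation of the same process) occurs and runs solo. Moreover $\tilde r$ can be chosen such that it inherits from $r$ each of the two fairness conditions: every nonempty buffer is eventually propagated from; every process that from some time on always has an enabled non-null action of its protocol eventually moves. -/

import Mathlib

namespace TSO

/-- Agents of a system with `n` processes: the processes `i` and their local dispatchers `d_i`. -/
inductive Agent (n : ℕ) where
  | proc (i : Fin n)
  | disp (i : Fin n)

/-- The actions that a protocol can prescribe to a process: `R[x]`, `W[x,v]`, `F`,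
`RMW[x,v_exp,v_new]`, the null action, internal actions, and `return(O)`. -/
inductive Action (Var Val Op Intl : Type*) where
  | null
  | read (x : Var)
  | write (x : Var) (v : Val)
  | fence
  | rmw (x : Var) (vexp vnew : Val)
  | internal (a : Intl)
  | ret (O : Op)

/-- Events: what takes place when an agent acts (`null` if the agent does not move).
A read action results in a read from the buffer (`rfb`) or a read from memory (`rfm`);
`prop x v` is an event of a dispatcher, and all non-null others are events of processes. -/
inductive Event (Var Val Op Intl : Type*) where
  | null
  | write (x : Var) (v : Val)
  | rfb (x : Var) (v : Val)
  | rfm (x : Var) (v : Val)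
  | fence
  | rmw (x : Var) (vexp vnew : Val)
  | internal (a : Intl)
  | ret (O : Op)
  | prop (x : Var) (v : Val)

/-- Entries of a local state. A read is recorded without its source (buffer or memory). -/
inductive Record (Var Val Op Intl : Type*) where
  | read (x : Var) (v : Val)
  | write (x : Var) (v : Val)
  | fence
  | rmw (x : Var) (vexp vnew : Val)
  | internal (a : Intl)
  | ret (O : Op)
  | invoke (O : Op)

/-- A local state is the history of a process, oldest record first. -/
abbrev LocalState (Var Val Op Intl : Type*) := List (Record Var Val Op Intl)

/-- A basic TSO state: main memory, and a FIFO store buffer (oldest item first) per process. -/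
structure MemState (n : ℕ) (Var Val : Type*) where
  mem : Var → Val
  buf : Fin n → List (Var × Val)

/-- A global state: a basic TSO state and a local state for every process. -/
structure GlobalState (n : ℕ) (Var Val Op Intl : Type*) where
  tso : MemState n Var Val
  loc : Fin n → LocalState Var Val Op Intl

/-- A (nondeterministic) protocol. -/
structure Protocol (n : ℕ) (Var Val Op Intl : Type*) where
  acts : Fin n → LocalState Var Val Op Intl → Set (Action Var Val Op Intl)
  nonempty : ∀ i l, (acts i l).Nonempty

namespace Event

variable {Var Val Op Intl : Type*}

/-- The process action of which the event is an outcome. -/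
def action : Event Var Val Op Intl → Option (Action Var Val Op Intl)
  | null => some .null
  | write x v => some (.write x v)
  | rfb x _ => some (.read x)
  | rfm x _ => some (.read x)
  | fence => some .fence
  | rmw x a b => some (.rmw x a b)
  | internal a => some (.internal a)
  | ret O => some (.ret O)
  | prop _ _ => none

/-- What the acting process adds to its local state. -/
def record : Event Var Val Op Intl → List (Record Var Val Op Intl)
  | null => []
  | write x v => [.write x v]
  | rfb x v => [.read x v]
  | rfm x v => [.read x v]
  | fence => [.fence]
  | rmw x a b => [.rmw x a b]
  | internal a => [.internal a]
  | ret O => [.ret O]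
  | prop _ _ => []

/-- The variable of which the event is a memory access, if it is one. -/
def memVar : Event Var Val Op Intl → Option Var
  | rfm x _ => some x
  | rmw x _ _ => some x
  | prop x _ => some x
  | _ => none

def isRfM : Event Var Val Op Intl → Bool
  | rfm _ _ => true
  | _ => false

def isRfB : Event Var Val Op Intl → Bool
  | rfb _ _ => true
  | _ => false

def isWrite : Event Var Val Op Intl → Bool
  | write _ _ => true
  | _ => false

def isProp : Event Var Val Op Intl → Bool
  | prop _ _ => true
  | _ => false

def isFenceOrRMW : Event Var Val Op Intl → Bool
  | fence => true
  | rmw _ _ _ => true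
  | _ => false

end Event

section Semantics

variable {n : ℕ} {Var Val Op Intl : Type*} [DecidableEq Var]

/-- The items of a store buffer that concern the variable `x`. -/
def restrict (β : List (Var × Val)) (x : Var) : List (Var × Val) :=
  β.filter fun p => p.1 = x

/-- The precondition of an event of an agent in a basic TSO state. -/
def Enabled (σ : MemState n Var Val) : Agent n → Event Var Val Op Intl → Prop
  | .proc _, .null => True
  | .proc _, .write _ _ => True
  | .proc i, .rfb x v => (restrict (σ.buf i) x).getLast? = some (x, v)
  | .proc i, .rfm x v => restrict (σ.buf i) x = [] ∧ σ.mem x = v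
  | .proc i, .fence => σ.buf i = []
  | .proc i, .rmw x vexp _ => σ.buf i = [] ∧ σ.mem x = vexp
  | .proc _, .internal _ => True
  | .proc _, .ret _ => True
  | .proc _, .prop _ _ => False
  | .disp _, .null => True
  | .disp i, .prop x v => (σ.buf i).head? = some (x, v)
  | .disp _, _ => False

/-- The effect of an event of an agent on a basic TSO state. -/
def effect (σ : MemState n Var Val) : Agent n → Event Var Val Op Intl → MemState n Var Val
  | .proc i, .write x v => { σ with buf := Function.update σ.buf i (σ.buf i ++ [(x, v)]) }
  | .proc _, .rmw x _ vnew => { σ with mem := Function.update σ.mem x vnew }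
  | .disp i, .prop x v =>
      { mem := Function.update σ.mem x v, buf := Function.update σ.buf i (σ.buf i).tail }
  | _, _ => σ

/-- The agents in the order in which a joint action is carried out: `1, …, n, d_1, …, d_n`. -/
def agentList (n : ℕ) : List (Agent n) :=
  (List.finRange n).map Agent.proc ++ (List.finRange n).map Agent.disp

/-- The effect of a joint action on a basic TSO state: its events one by one, in order. -/
def jointEffect (σ : MemState n Var Val) (e : Agent n → Event Var Val Op Intl) :
    MemState n Var Val :=
  (agentList n).foldl (fun σ' b => effect σ' b (e b)) σ

/-- Conflicting events `e` at agent `b` and `e'` at agent `b'`. -/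
def Conflicting (b : Agent n) (e : Event Var Val Op Intl) (b' : Agent n)
    (e' : Event Var Val Op Intl) : Prop :=
  ¬ (e.isRfM ∧ e'.isRfM) ∧
  (∃ x, e.memVar = some x ∧ e'.memVar = some x) ∧
  ¬ (∃ i, (b = .disp i ∧ e.isProp ∧ b' = .proc i ∧ e'.isRfM) ∨
          (b' = .disp i ∧ e'.isProp ∧ b = .proc i ∧ e.isRfM))

end Semantics

/-- The data of a run: the global state at time `t`, the events of the agents at time `t`
(that is, in round `t + 1`, which leads from time `t` to time `t + 1`), and the invocations that
the environment issues at time `t`. See `Run.IsRunOf` for the laws. -/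
structure Run (n : ℕ) (Var Val Op Intl : Type*) where
  state : ℕ → GlobalState n Var Val Op Intl
  ev : ℕ → Agent n → Event Var Val Op Intl
  inv : ℕ → Fin n → Option Op

namespace Run

variable {n : ℕ} {Var Val Op Intl : Type*}

/-- `r` is a TSO run of the protocol `P`. -/
structure IsRunOf [DecidableEq Var] (r : Run n Var Val Op Intl) (P : Protocol n Var Val Op Intl) :
    Prop where
  init_buf : ∀ i, (r.state 0).tso.buf i = []
  init_loc : ∀ i, (r.state 0).loc i = []
  enabled : ∀ t b, Enabled (r.state t).tso b (r.ev t b)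
  no_conflict : ∀ t b b', b ≠ b' → ¬ Conflicting b (r.ev t b) b' (r.ev t b')
  step_tso : ∀ t, (r.state (t + 1)).tso = jointEffect (r.state t).tso (r.ev t)
  step_loc : ∀ t i, (r.state (t + 1)).loc i =
    (r.state t).loc i ++ (r.ev t (.proc i)).record ++ ((r.inv t i).map Record.invoke).toList
  follows : ∀ t i, r.ev t (.proc i) ≠ .null →
    ∃ a ∈ P.acts i ((r.state t).loc i), (r.ev t (.proc i)).action = some a
  /-- After an invocation, the environment issues no other one to the same process before
  the process has performed a matching return. -/
  one_pending : ∀ i O t t', t < t' → r.inv t i = some O → r.inv t' i ≠ none →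
    ∃ τ, t < τ ∧ τ ≤ t' ∧ r.ev τ (.proc i) = .ret O

/-- The number of writes by process `i` before time `t`. -/
def numWrites (r : Run n Var Val Op Intl) (i : Fin n) (t : ℕ) : ℕ :=
  Nat.count (fun s => (r.ev s (.proc i)).isWrite = true) t

/-- The number of propagations by dispatcher `d_i` before time `t`. -/
def numProps (r : Run n Var Val Op Intl) (i : Fin n) (t : ℕ) : ℕ :=
  Nat.count (fun s => (r.ev s (.disp i)).isProp = true) t

/-- `r.HasTag b t (i, k)`: the event at node `⟨b, t⟩` writes, propagates or reads from the buffer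
the item that is created by the write number `k` (counted from `0`) of process `i`. Buffers are
queues, so the item at position `p` of the buffer of `i` at time `t` is the one created by the write
number `r.numProps i t + p`. -/
inductive HasTag (r : Run n Var Val Op Intl) : Agent n → ℕ → Fin n × ℕ → Prop
  | write (i : Fin n) (t : ℕ) (x : Var) (v : Val) (h : r.ev t (.proc i) = .write x v) :
      HasTag r (.proc i) t (i, r.numWrites i t)
  | rfb (i : Fin n) (t : ℕ) (x : Var) (v : Val) (β₁ β₂ : List (Var × Val))
      (h : r.ev t (.proc i) = .rfb x v) (hβ : (r.state t).tso.buf i = β₁ ++ (x, v) :: β₂)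
      (hlast : ∀ p ∈ β₂, p.1 ≠ x) :
      HasTag r (.proc i) t (i, r.numProps i t + β₁.length)
  | prop (i : Fin n) (t : ℕ) (x : Var) (v : Val) (h : r.ev t (.disp i) = .prop x v) :
      HasTag r (.disp i) t (i, r.numProps i t)

/-- The occurs-before relation between nodes `⟨b, t⟩` of a run. -/
inductive OccursBefore (r : Run n Var Val Op Intl) : Agent n × ℕ → Agent n × ℕ → Prop
  | locality (b : Agent n) (t t' : ℕ) (ht : t < t') : OccursBefore r (b, t) (b, t')
  | buffer (i : Fin n) (t t' : ℕ) (κ : Fin n × ℕ) (ht : t < t')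
      (h : (r.ev t (.proc i)).isWrite ∨ (r.ev t (.proc i)).isRfB)
      (h' : (r.ev t' (.disp i)).isProp)
      (hκ : r.HasTag (.proc i) t κ) (hκ' : r.HasTag (.disp i) t' κ) :
      OccursBefore r (.proc i, t) (.disp i, t')
  | memory (b c : Agent n) (t t' : ℕ) (x : Var) (ht : t < t')
      (h : (r.ev t b).memVar = some x) (h' : (r.ev t' c).memVar = some x)
      (hreads : ¬ ((r.ev t b).isRfM ∧ (r.ev t' c).isRfM))
      (hown : ¬ ∃ i, b = .disp i ∧ c = .proc i ∧ (r.ev t b).isProp ∧ (r.ev t' c).isRfM) :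
      OccursBefore r (b, t) (c, t')
  | fence (i : Fin n) (t t' : ℕ) (ht : t < t')
      (h : (r.ev t (.disp i)).isProp) (h' : (r.ev t' (.proc i)).isFenceOrRMW) :
      OccursBefore r (.disp i, t) (.proc i, t')
  | trans (θ₁ θ₂ θ₃ : Agent n × ℕ) (h : OccursBefore r θ₁ θ₂) (h' : OccursBefore r θ₂ θ₃) :
      OccursBefore r θ₁ θ₃

/-- No item is read from the buffer of a process in the round in which it is propagated. -/
def BufferReadsSeparate (r : Run n Var Val Op Intl) : Prop :=
  ∀ i t κ, (r.ev t (.proc i)).isRfB → r.HasTag (.proc i) t κ → ¬ r.HasTag (.disp i) t κ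

/-- There is a feedback loop between `⟨i, t₁⟩` and `⟨i, t₂⟩`. -/
def FeedbackLoop (r : Run n Var Val Op Intl) (i : Fin n) (t₁ t₂ : ℕ) : Prop :=
  ∃ b t, b ≠ .proc i ∧ b ≠ .disp i ∧
    r.OccursBefore (.proc i, t₁) (b, t) ∧ r.OccursBefore (b, t) (.proc i, t₂)

/-- Local equivalence: every process goes through the same local states. -/
def LocallyEquivalent (r r' : Run n Var Val Op Intl) : Prop :=
  ∀ j l, (∃ t, (r.state t).loc j = l) ↔ ∃ t, (r'.state t).loc j = l

/-- Only process `i` and its dispatcher take actions between the times `s` and `e`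
(both included). -/
def SoloBetween (r : Run n Var Val Op Intl) (i : Fin n) (s e : ℕ) : Prop :=
  ∀ t, s ≤ t → t ≤ e → ∀ b, b ≠ .proc i → b ≠ .disp i → r.ev t b = .null

/-- Every nonempty buffer is eventually propagated from. -/
def PropFair (r : Run n Var Val Op Intl) : Prop :=
  ∀ i t, (r.state t).tso.buf i ≠ [] → ∃ t', t ≤ t' ∧ (r.ev t' (.disp i)).isProp

/-- At time `t`, process `i` has an enabled non-null action to perform according to `P`. -/
def CanMove [DecidableEq Var] (r : Run n Var Val Op Intl) (P : Protocol n Var Val Op Intl)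
    (i : Fin n) (t : ℕ) : Prop :=
  ∃ e : Event Var Val Op Intl, e ≠ .null ∧ Enabled (r.state t).tso (.proc i) e ∧
    ∃ a ∈ P.acts i ((r.state t).loc i), e.action = some a

/-- A process that has an enabled action from some time on eventually moves. -/
def ProcFair [DecidableEq Var] (r : Run n Var Val Op Intl) (P : Protocol n Var Val Op Intl) :
    Prop :=
  ∀ i t, (∀ t', t ≤ t' → r.CanMove P i t') → ∃ t', t ≤ t' ∧ r.ev t' (.proc i) ≠ .null

end Run

/-- An operation instance: the invocation number `index` (counted from `0`) issued to the process
`proc`, of the operation named `name`. -/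
structure Operation (n : ℕ) (Op : Type*) where
  proc : Fin n
  name : Op
  index : ℕ

/-- The operation `X` occurs between `X.s = ⟨X.proc, s⟩` and `X.e = ⟨X.proc, e⟩` in `r`: it is invoked
at time `s` (in round `s + 1`), and its matching return, the first one after the invocation, is
performed in round `e` (at time `e - 1`). -/
def Operation.OccursBetween {n : ℕ} {Var Val Op Intl : Type*} (X : Operation n Op)
    (r : Run n Var Val Op Intl) (s e : ℕ) : Prop :=
  r.inv s X.proc = some X.name ∧
  Nat.count (fun t => (r.inv t X.proc).isSome = true) s = X.index ∧
  ∃ τ, s < τ ∧ e = τ + 1 ∧ r.ev τ (.proc X.proc) = .ret X.name ∧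
    ∀ τ', s < τ' → τ' < τ → r.ev τ' (.proc X.proc) ≠ .ret X.name

end TSO

/-! The proof reschedules the nodes of `r` in three phases: first the nodes up to time `e`, other
than `X.s` itself, that `X.s` does not influence; then the remaining nodes that influence `X.e`;
then all others. The first set is closed under predecessors of occurs-before, and so is the set of
nodes that influence `X.e`. The phase is therefore monotone along occurs-before, and within a phase
the original order is kept. A node of a foreign agent in the middle phase would lie between `X.s`
and `X.e`, which is a feedback loop. Hence only process `i` and `d_i` act in the middle block, which
contains `X`.

The main work is to show that every rescheduling that respects occurs-before, and makes only
originally simultaneous nodes simultaneous, yields a run of the same protocol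
(`Reordering.isRunOf_run`). Two descriptions of the state make this tractable. A buffer is the list
of items written so far, minus as many as have been propagated, so it depends only on how far `i`
and `d_i` have come. The memory value of `x` depends only on which modifications of `x` have taken
place. Modifications of `x` at different times are ordered by occurs-before, and no two take place
in the same round, so the ones performed form an initial segment of those in `r`.

The delicate events are reads. Occurs-before does not order a `prop` of `d_i` before a later `RfM`
of `i`, so the propagation may be postponed beyond the read. The read then finds the item in the
buffer, and `restrict_buf_of_rfm` shows that it still returns the same value. Local states record no
source, so they do not change.

After time `e` all nodes are in the last phase and are merely delayed by a constant, which preserves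
fairness. -/

namespace TSO

/-! ### Events and the effect of one round on memory and buffers -/

namespace Event

variable {Var Val Op Intl : Type*}

/-- The item that the event appends to the buffer of the acting process. -/
def written : Event Var Val Op Intl → List (Var × Val)
  | write x v => [(x, v)]
  | _ => []

theorem exists_of_isWrite {e : Event Var Val Op Intl} (h : e.isWrite = true) :
    ∃ x v, e = write x v := by
  cases e <;> simp_all [isWrite]

theorem exists_of_isRfB {e : Event Var Val Op Intl} (h : e.isRfB = true) :
    ∃ x v, e = rfb x v := by
  cases e <;> simp_all [isRfB]

theorem exists_of_isProp {e : Event Var Val Op Intl} (h : e.isProp = true) :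
    ∃ x v, e = prop x v := by
  cases e <;> simp_all [isProp]

theorem length_written (e : Event Var Val Op Intl) :
    e.written.length = if e.isWrite = true then 1 else 0 := by
  cases e <;> simp [written, isWrite]

end Event

section JointEffect

variable {n : ℕ} {Var Val Op Intl : Type*} [DecidableEq Var]

/-- The value that an event of agent `b` stores in the variable `x` of the main memory, if any. -/
def modVal (x : Var) : Agent n → Event Var Val Op Intl → Option Val
  | .proc _, .rmw y _ w => if y = x then some w else none
  | .disp _, .prop y w => if y = x then some w else none
  | _, _ => none

theorem modVal_eq_some {x : Var} {b : Agent n} {e : Event Var Val Op Intl} {w : Val}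
    (h : modVal x b e = some w) :
    (∃ i a, b = .proc i ∧ e = .rmw x a w) ∨ (∃ i, b = .disp i ∧ e = .prop x w) := by
  cases b <;> cases e <;> simp_all [modVal]

theorem memVar_of_modVal {x : Var} {b : Agent n} {e : Event Var Val Op Intl}
    (h : modVal x b e ≠ none) : e.memVar = some x ∧ e.isRfM = false := by
  obtain ⟨w, hw⟩ := Option.ne_none_iff_exists'.1 h
  rcases modVal_eq_some hw with ⟨i, a, -, rfl⟩ | ⟨i, -, rfl⟩ <;> simp [Event.memVar, Event.isRfM]

theorem effect_mem (σ : MemState n Var Val) (b : Agent n) (e : Event Var Val Op Intl) (x : Var) :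
    (effect σ b e).mem x = (modVal x b e).getD (σ.mem x) := by
  cases b <;> cases e <;> simp [effect, modVal, Function.update_apply, eq_comm] <;>
    split_ifs <;> simp

/-- All events that store into `x` store the same value, so the order in which the agents act is
immaterial. -/
theorem foldl_effect_mem (l : List (Agent n)) (σ : MemState n Var Val)
    (e : Agent n → Event Var Val Op Intl) (x : Var) (v : Val)
    (huniq : ∀ b ∈ l, ∀ w, modVal x b (e b) = some w → w = v)
    (hex : σ.mem x = v ∨ ∃ b ∈ l, modVal x b (e b) = some v) :
    (l.foldl (fun σ' b => effect σ' b (e b)) σ).mem x = v := by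
  induction l generalizing σ with
  | nil => simpa using hex
  | cons b l ih =>
    rw [List.foldl_cons]
    refine ih _ (fun c hc => huniq c (List.mem_cons_of_mem _ hc)) ?_
    rw [effect_mem]
    have hb := huniq b List.mem_cons_self
    cases hm : modVal x b (e b) with
    | some w => exact Or.inl (hb w hm)
    | none =>
      rcases hex with h | ⟨c, hc, h⟩
      · exact Or.inl h
      · rcases List.mem_cons.1 hc with rfl | hc
        · simp [hm] at h
        · exact Or.inr ⟨c, hc, h⟩

theorem mem_agentList (b : Agent n) : b ∈ agentList n := by
  cases b <;> simp [agentList]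

theorem jointEffect_mem_of_none (σ : MemState n Var Val) (e : Agent n → Event Var Val Op Intl)
    (x : Var) (h : ∀ b, modVal x b (e b) = none) : (jointEffect σ e).mem x = σ.mem x :=
  foldl_effect_mem _ _ _ _ _ (fun b _ w hw => by simp [h b] at hw) (Or.inl rfl)

theorem jointEffect_mem_of_some (σ : MemState n Var Val) (e : Agent n → Event Var Val Op Intl)
    (x : Var) (b : Agent n) (v : Val) (hb : modVal x b (e b) = some v)
    (h : ∀ c, c ≠ b → modVal x c (e c) = none) : (jointEffect σ e).mem x = v := by
  refine foldl_effect_mem _ _ _ _ _ (fun c _ w hw => ?_) (Or.inr ⟨b, mem_agentList b, hb⟩)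
  by_cases hcb : c = b
  · subst hcb
    simpa [hb, eq_comm] using hw
  · simp [h c hcb] at hw

theorem effect_proc_buf (σ : MemState n Var Val) (i j : Fin n) (e : Event Var Val Op Intl) :
    (effect σ (.proc j) e).buf i = if i = j then σ.buf i ++ e.written else σ.buf i := by
  by_cases h : i = j
  · subst h
    cases e <;> simp [effect, Event.written]
  · cases e <;> simp [effect, h]

theorem effect_disp_buf (σ : MemState n Var Val) (i j : Fin n) (e : Event Var Val Op Intl) :
    (effect σ (.disp j) e).buf i =
      if i = j ∧ e.isProp = true then (σ.buf i).tail else σ.buf i := by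
  by_cases h : i = j
  · subst h
    cases e <;> simp [effect, Event.isProp]
  · cases e <;> simp [effect, h]

theorem foldl_proc_buf (l : List (Fin n)) (hl : l.Nodup) (σ : MemState n Var Val)
    (e : Agent n → Event Var Val Op Intl) (i : Fin n) :
    ((l.map Agent.proc).foldl (fun σ' b => effect σ' b (e b)) σ).buf i =
      if i ∈ l then σ.buf i ++ (e (.proc i)).written else σ.buf i := by
  induction l generalizing σ with
  | nil => simp
  | cons j l ih =>
    obtain ⟨hj, hl⟩ := List.nodup_cons.1 hl
    rw [List.map_cons, List.foldl_cons, ih hl, effect_proc_buf]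
    by_cases h : i = j
    · subst h
      simp [hj]
    · simp [h]

theorem foldl_disp_buf (l : List (Fin n)) (hl : l.Nodup) (σ : MemState n Var Val)
    (e : Agent n → Event Var Val Op Intl) (i : Fin n) :
    ((l.map Agent.disp).foldl (fun σ' b => effect σ' b (e b)) σ).buf i =
      if i ∈ l ∧ (e (.disp i)).isProp = true then (σ.buf i).tail else σ.buf i := by
  induction l generalizing σ with
  | nil => simp
  | cons j l ih =>
    obtain ⟨hj, hl⟩ := List.nodup_cons.1 hl
    rw [List.map_cons, List.foldl_cons, ih hl, effect_disp_buf]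
    by_cases h : i = j
    · subst h
      simp [hj]
    · simp [h]

/-- Processes act before dispatchers, so the new item is appended before the oldest one is removed.
-/
theorem jointEffect_buf (σ : MemState n Var Val) (e : Agent n → Event Var Val Op Intl)
    (i : Fin n) :
    (jointEffect σ e).buf i =
      if (e (.disp i)).isProp = true then (σ.buf i ++ (e (.proc i)).written).tail
      else σ.buf i ++ (e (.proc i)).written := by
  simp only [jointEffect, agentList, List.foldl_append]
  rw [foldl_disp_buf _ (List.nodup_finRange n), foldl_proc_buf _ (List.nodup_finRange n)]
  simp

theorem conflicting_of_modVal {x : Var} {b c : Agent n} {e e' : Event Var Val Op Intl}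
    (h : modVal x b e ≠ none) (h' : modVal x c e' ≠ none) : Conflicting b e c e' := by
  obtain ⟨h1, h2⟩ := memVar_of_modVal h
  obtain ⟨h3, h4⟩ := memVar_of_modVal h'
  exact ⟨by simp [h2], ⟨x, h1, h3⟩, by simp [h2, h4]⟩

theorem restrict_eq_nil {β : List (Var × Val)} {x : Var} :
    restrict β x = [] ↔ ∀ p ∈ β, p.1 ≠ x := by
  simp [restrict, List.filter_eq_nil_iff]

theorem exists_split_of_restrict {β : List (Var × Val)} {x : Var} {p : Var × Val}
    (h : (restrict β x).getLast? = some p) :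
    p.1 = x ∧ ∃ β₁ β₂, β = β₁ ++ p :: β₂ ∧ ∀ q ∈ β₂, q.1 ≠ x := by
  induction β using List.reverseRecOn with
  | nil => simp [restrict] at h
  | append_singleton β a ih =>
    by_cases ha : a.1 = x
    · simp [restrict, List.filter_append, ha] at h
      subst h
      exact ⟨ha, β, [], rfl, by simp⟩
    · simp only [restrict, List.filter_append] at h
      simp [ha] at h
      obtain ⟨hp, β₁, β₂, rfl, h2⟩ := ih (by simpa [restrict] using h)
      refine ⟨hp, β₁, β₂ ++ [a], by simp, fun q hq => ?_⟩
      rcases List.mem_append.1 hq with hq | hq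
      · exact h2 q hq
      · rw [List.mem_singleton.1 hq]
        exact ha

theorem restrict_getLast?_of_split {β₁ β₂ : List (Var × Val)} {x : Var} {v : Val}
    (h : ∀ q ∈ β₂, q.1 ≠ x) :
    (restrict (β₁ ++ (x, v) :: β₂) x).getLast? = some (x, v) := by
  have h2 : restrict β₂ x = [] := restrict_eq_nil.2 h
  simp only [restrict] at h2
  simp [restrict, List.filter_append, h2]

end JointEffect

theorem exists_count_eq {p : ℕ → Prop} [DecidablePred p] {k t : ℕ} (h : k < Nat.count p t) :
    ∃ s < t, p s ∧ Nat.count p s = k := by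
  induction t with
  | zero => simp at h
  | succ t ih =>
    rw [Nat.count_succ] at h
    by_cases hk : k < Nat.count p t
    · obtain ⟨s, hs, h⟩ := ih hk
      exact ⟨s, hs.trans (Nat.lt_succ_self t), h⟩
    · split_ifs at h with hp
      · exact ⟨t, Nat.lt_succ_self t, hp, by omega⟩
      · omega

/-! ### Buffers and memory along a run, expressed by writes, propagations and modifications -/

namespace Run

variable {n : ℕ} {Var Val Op Intl : Type*}

/-- The items written by process `i` before time `t`, oldest first. -/
def writes (r : Run n Var Val Op Intl) (i : Fin n) (t : ℕ) : List (Var × Val) :=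
  (List.range t).flatMap fun s => (r.ev s (.proc i)).written

theorem writes_succ (r : Run n Var Val Op Intl) (i : Fin n) (t : ℕ) :
    r.writes i (t + 1) = r.writes i t ++ (r.ev t (.proc i)).written := by
  simp [writes, List.range_succ]

theorem length_writes (r : Run n Var Val Op Intl) (i : Fin n) (t : ℕ) :
    (r.writes i t).length = r.numWrites i t := by
  induction t with
  | zero => simp [writes, numWrites]
  | succ t ih =>
    rw [writes_succ, List.length_append, ih, numWrites, numWrites, Nat.count_succ,
      Event.length_written]

theorem writes_prefix (r : Run n Var Val Op Intl) (i : Fin n) {t t' : ℕ} (h : t ≤ t') :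
    r.writes i t <+: r.writes i t' := by
  induction t', h using Nat.le_induction with
  | base => exact List.prefix_rfl
  | succ m _ ih => exact ih.trans ⟨_, (r.writes_succ i m).symm⟩

theorem writes_getElem?_of_lt (r : Run n Var Val Op Intl) (i : Fin n) {t t' k : ℕ}
    {p : Var × Val} (h : (r.writes i t)[k]? = some p) (hk : k < (r.writes i t').length) :
    (r.writes i t')[k]? = some p := by
  rcases le_total t t' with htt | htt
  · obtain ⟨l, hl⟩ := r.writes_prefix i htt
    rw [← hl, List.getElem?_append_left (List.getElem?_eq_some_iff.1 h).1, h]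
  · obtain ⟨l, hl⟩ := r.writes_prefix i htt
    rwa [← hl, List.getElem?_append_left hk] at h

theorem numProps_mono (r : Run n Var Val Op Intl) (i : Fin n) : Monotone (r.numProps i) :=
  Nat.count_monotone _

theorem numProps_lt (r : Run n Var Val Op Intl) {i : Fin n} {t t' : ℕ}
    (h : (r.ev t (.disp i)).isProp = true) (ht : t < t') : r.numProps i t < r.numProps i t' :=
  Nat.count_strict_mono h ht

namespace IsRunOf

variable [DecidableEq Var] {r : Run n Var Val Op Intl} {P : Protocol n Var Val Op Intl}

/-- A FIFO queue is determined by its input and the number of removals. The bound persists because a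
propagation is enabled only on a nonempty buffer. -/
theorem buf_eq (hr : r.IsRunOf P) (i : Fin n) (t : ℕ) :
    (r.state t).tso.buf i = (r.writes i t).drop (r.numProps i t) ∧
      r.numProps i t ≤ (r.writes i t).length := by
  induction t with
  | zero => simp [hr.init_buf, writes, numProps]
  | succ t ih =>
    obtain ⟨h1, h2⟩ := ih
    rw [hr.step_tso, jointEffect_buf, writes_succ, numProps, Nat.count_succ, ← numProps, h1]
    by_cases hp : (r.ev t (.disp i)).isProp = true
    · obtain ⟨x, v, hx⟩ := Event.exists_of_isProp hp
      have hen := hr.enabled t (.disp i)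
      rw [hx, Enabled, h1, List.head?_drop] at hen
      have hlt := (List.getElem?_eq_some_iff.1 hen).1
      simp only [hp, if_true, List.length_append]
      refine ⟨?_, by omega⟩
      rw [← List.drop_append_of_le_length h2, List.tail_drop]
    · simp only [hp, List.length_append]
      refine ⟨?_, by simp; omega⟩
      simp [List.drop_append_of_le_length h2]

theorem writes_getElem?_of_prop (hr : r.IsRunOf P) {i : Fin n} {t : ℕ} {x : Var} {v : Val}
    (h : r.ev t (.disp i) = .prop x v) : (r.writes i t)[r.numProps i t]? = some (x, v) := by
  have hen := hr.enabled t (.disp i)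
  rwa [h, Enabled, (hr.buf_eq i t).1, List.head?_drop] at hen

theorem modVal_unique (hr : r.IsRunOf P) {x : Var} {t : ℕ} {b c : Agent n}
    (hb : modVal x b (r.ev t b) ≠ none) (hc : modVal x c (r.ev t c) ≠ none) : b = c := by
  by_contra h
  exact hr.no_conflict t b c h (conflicting_of_modVal hb hc)

theorem mem_succ_of_modVal (hr : r.IsRunOf P) {x : Var} {t : ℕ} {b : Agent n} {v : Val}
    (hb : modVal x b (r.ev t b) = some v) : (r.state (t + 1)).tso.mem x = v := by
  rw [hr.step_tso]
  refine jointEffect_mem_of_some _ _ _ b v hb fun c hc => ?_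
  by_contra h
  exact hc (hr.modVal_unique h (by simp [hb]))

theorem mem_eq_of_no_mod (hr : r.IsRunOf P) {x : Var} {t t' : ℕ} (h : t ≤ t')
    (hno : ∀ u, t ≤ u → u < t' → ∀ b, modVal x b (r.ev u b) = none) :
    (r.state t').tso.mem x = (r.state t).tso.mem x := by
  induction t', h using Nat.le_induction with
  | base => rfl
  | succ m hm ih =>
    rw [hr.step_tso, jointEffect_mem_of_none _ _ _ (hno m hm (Nat.lt_succ_self m))]
    exact ih fun u h1 h2 => hno u h1 (h2.trans (Nat.lt_succ_self m))

end IsRunOf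

theorem OccursBefore.time_lt {r : Run n Var Val Op Intl} {θ θ' : Agent n × ℕ}
    (h : r.OccursBefore θ θ') : θ.2 < θ'.2 := by
  induction h with
  | trans _ _ _ _ _ h1 h2 => exact h1.trans h2
  | _ => assumption

/-- The exceptions in the memory clause of occurs-before all involve an `RfM`, which modifies
nothing. -/
theorem occursBefore_of_modVal [DecidableEq Var] {r : Run n Var Val Op Intl} {x : Var}
    {b c : Agent n} {t t' : ℕ} (ht : t < t') (h : modVal x b (r.ev t b) ≠ none)
    (h' : modVal x c (r.ev t' c) ≠ none) : r.OccursBefore (b, t) (c, t') := by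
  obtain ⟨h1, h2⟩ := memVar_of_modVal h
  obtain ⟨h3, h4⟩ := memVar_of_modVal h'
  exact .memory b c t t' x ht h1 h3 (by simp [h2]) (by simp [h4])

/-- Every propagation is preceded by the write that creates the item. -/
theorem IsRunOf.exists_write_occursBefore [DecidableEq Var] {r : Run n Var Val Op Intl}
    {P : Protocol n Var Val Op Intl} (hr : r.IsRunOf P) {i : Fin n} {t : ℕ}
    (h : (r.ev t (.disp i)).isProp = true) :
    ∃ t₀, r.OccursBefore (.proc i, t₀) (.disp i, t) ∧
      r.numProps i t < (r.writes i (t₀ + 1)).length := by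
  obtain ⟨x, v, hx⟩ := Event.exists_of_isProp h
  have hlt := (List.getElem?_eq_some_iff.1 (hr.writes_getElem?_of_prop hx)).1
  rw [length_writes] at hlt
  obtain ⟨t₀, ht₀, hw, hk⟩ := exists_count_eq hlt
  obtain ⟨y, w, hy⟩ := Event.exists_of_isWrite hw
  refine ⟨t₀, .buffer i t₀ t (i, r.numProps i t) ht₀ (Or.inl hw) h ?_ (.prop i t x v hx), ?_⟩
  · rw [← hk]
    exact .write i t₀ y w hy
  · rw [length_writes, numWrites, Nat.count_succ, hk, if_pos hw]
    exact Nat.lt_succ_self _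

end Run

/-! ### Reschedulings and the run that they induce -/

variable {n : ℕ} {Var Val Op Intl : Type*}

/-- A rescheduling of the nodes of `r` that respects the occurs-before relation, and makes only such
nodes simultaneous that are simultaneous in `r`. -/
structure Reordering (r : Run n Var Val Op Intl) where
  pos : Agent n → ℕ → ℕ
  pos_lt : ∀ {b t c t'}, r.OccursBefore (b, t) (c, t') → pos b t < pos c t'
  time_eq : ∀ {b t c t'}, pos b t = pos c t' → t = t'

/-- A read from memory becomes a read from the buffer if the buffer `β` has an item for the
variable. -/
def Event.resource [DecidableEq Var] (β : List (Var × Val)) :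
    Event Var Val Op Intl → Event Var Val Op Intl
  | .rfm x v => if (restrict β x).isEmpty then .rfm x v else .rfb x v
  | e => e

section Resource

variable [DecidableEq Var] (β : List (Var × Val)) (e : Event Var Val Op Intl)

theorem Event.resource_record : (e.resource β).record = e.record := by
  cases e <;> simp only [resource]
  split_ifs <;> rfl

theorem Event.resource_action : (e.resource β).action = e.action := by
  cases e <;> simp only [resource]
  split_ifs <;> rfl

theorem Event.resource_written : (e.resource β).written = e.written := by
  cases e <;> simp only [resource]
  split_ifs <;> rfl

theorem Event.resource_eq_null : e.resource β = .null ↔ e = .null := by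
  cases e <;> simp only [resource, reduceCtorEq]
  split_ifs <;> simp

theorem Event.resource_eq_ret (O : Op) : e.resource β = .ret O ↔ e = .ret O := by
  cases e <;> simp only [resource, reduceCtorEq]
  split_ifs <;> simp

theorem Event.resource_eq_of_memVar {x : Var} (h : (e.resource β).memVar = some x) :
    e.resource β = e := by
  cases e <;> simp only [resource] at h ⊢
  split_ifs at h ⊢ with hb
  · rfl
  · simp [memVar] at h

theorem modVal_resource (x : Var) (b : Agent n) :
    modVal x b (e.resource β) = modVal x b e := by
  cases e <;> simp only [Event.resource]
  split_ifs <;> cases b <;> rfl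

end Resource

namespace Reordering

variable {r : Run n Var Val Op Intl} (ρ : Reordering r)

theorem pos_strictMono (b : Agent n) : StrictMono (ρ.pos b) :=
  fun t t' h => ρ.pos_lt (.locality b t t' h)

theorem exists_le_pos (b : Agent n) (T : ℕ) : ∃ t, T ≤ ρ.pos b t :=
  ⟨T, (ρ.pos_strictMono b).le_apply⟩

/-- The first node of agent `b` that is not scheduled before `T`. -/
def front (b : Agent n) (T : ℕ) : ℕ := Nat.find (ρ.exists_le_pos b T)

theorem lt_front {b : Agent n} {t T : ℕ} : t < ρ.front b T ↔ ρ.pos b t < T := by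
  rw [front, Nat.lt_find_iff]
  refine ⟨fun h => not_le.1 (h t le_rfl), fun h m hm => not_le.2 ?_⟩
  exact ((ρ.pos_strictMono b).monotone hm).trans_lt h

theorem front_eq {b : Agent n} {t T : ℕ} (h : ρ.pos b t = T) : ρ.front b T = t := by
  refine eq_of_forall_lt_iff fun u => ?_
  rw [lt_front, ← h, (ρ.pos_strictMono b).lt_iff_lt]

/-- Agent `b` performs one of its nodes at time `T`. -/
abbrev Active (b : Agent n) (T : ℕ) : Prop := ρ.pos b (ρ.front b T) = T

theorem front_zero (b : Agent n) : ρ.front b 0 = 0 := by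
  refine eq_of_forall_lt_iff fun u => ?_
  rw [lt_front]
  simp

theorem front_succ_of_active {b : Agent n} {T : ℕ} (h : ρ.Active b T) :
    ρ.front b (T + 1) = ρ.front b T + 1 := by
  refine eq_of_forall_lt_iff fun u => ?_
  rw [lt_front, Nat.lt_succ_iff, Nat.lt_succ_iff]
  conv_lhs => rw [← h]
  exact (ρ.pos_strictMono b).le_iff_le

theorem front_succ_of_not_active {b : Agent n} {T : ℕ} (h : ¬ ρ.Active b T) :
    ρ.front b (T + 1) = ρ.front b T := by
  refine eq_of_forall_lt_iff fun u => ?_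
  rw [lt_front, lt_front, Nat.lt_succ_iff, le_iff_lt_or_eq, or_iff_left_iff_imp]
  intro hu
  exact absurd (show ρ.Active b T by rw [Active, ρ.front_eq hu, hu]) h

theorem front_mono (b : Agent n) : Monotone (ρ.front b) := fun T T' h => by
  by_contra! hlt
  exact absurd (ρ.lt_front.2 ((ρ.lt_front.1 hlt).trans_le h)) (lt_irrefl _)

/-- `front` advances by one exactly at the active times. This transfers both the number of
propagations and the index of an invocation. -/
theorem count_eq {b : Agent n} {p q : ℕ → Prop} [DecidablePred p] [DecidablePred q]
    (h : ∀ T, q T ↔ ρ.Active b T ∧ p (ρ.front b T)) (T : ℕ) :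
    Nat.count q T = Nat.count p (ρ.front b T) := by
  induction T with
  | zero => simp [front_zero]
  | succ T ih =>
    rw [Nat.count_succ, ih]
    by_cases ha : ρ.Active b T
    · rw [ρ.front_succ_of_active ha, Nat.count_succ]
      simp only [h, and_iff_right ha]
    · rw [ρ.front_succ_of_not_active ha]
      simp [h, ha]

/-- The buffer of process `i` at time `T` of the rescheduled run. -/
def buf (i : Fin n) (T : ℕ) : List (Var × Val) :=
  (r.writes i (ρ.front (.proc i) T)).drop (r.numProps i (ρ.front (.disp i) T))

/-- Propagations are numbered consecutively, so their number cannot exceed `k` before number `k` has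
been carried out. -/
theorem numProps_le_of_forall {i : Fin n} {T k : ℕ}
    (h : ∀ t, (r.ev t (.disp i)).isProp = true → r.numProps i t = k → T ≤ ρ.pos (.disp i) t) :
    r.numProps i (ρ.front (.disp i) T) ≤ k := by
  by_contra! hlt
  obtain ⟨t, ht, hp, hk⟩ := exists_count_eq hlt
  exact absurd (ρ.lt_front.1 ht) (not_lt.2 (h t hp hk))

variable [DecidableEq Var]

theorem exists_memTime (T : ℕ) (x : Var) :
    ∃ u, ∀ b t, u ≤ t → modVal x b (r.ev t b) ≠ none → T ≤ ρ.pos b t :=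
  ⟨T, fun b _ h _ => h.trans (ρ.pos_strictMono b).le_apply⟩

open Classical in
/-- A time at which the value of `x` in `r` is the one at time `T` of the rescheduled run. -/
noncomputable def memTime (T : ℕ) (x : Var) : ℕ := Nat.find (ρ.exists_memTime T x)

/-- The rescheduled event of agent `b` at time `T`. -/
def ev (T : ℕ) (b : Agent n) : Event Var Val Op Intl :=
  if ρ.Active b T then
    match b with
    | .proc i => (r.ev (ρ.front (.proc i) T) (.proc i)).resource (ρ.buf i T)
    | .disp i => r.ev (ρ.front (.disp i) T) (.disp i)
  else .null

/-- The rescheduled run. -/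
noncomputable def run : Run n Var Val Op Intl where
  state T :=
    { tso := { mem := fun x => (r.state (ρ.memTime T x)).tso.mem x, buf := fun i => ρ.buf i T }
      loc := fun i => (r.state (ρ.front (.proc i) T)).loc i }
  ev := ρ.ev
  inv T i := if ρ.Active (.proc i) T then r.inv (ρ.front (.proc i) T) i else none

theorem ev_of_not_active {b : Agent n} {T : ℕ} (h : ¬ ρ.Active b T) : ρ.ev T b = .null :=
  if_neg h

theorem ev_proc {i : Fin n} {T : ℕ} (h : ρ.Active (.proc i) T) :
    ρ.ev T (.proc i) = (r.ev (ρ.front (.proc i) T) (.proc i)).resource (ρ.buf i T) :=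
  if_pos h

theorem ev_disp {i : Fin n} {T : ℕ} (h : ρ.Active (.disp i) T) :
    ρ.ev T (.disp i) = r.ev (ρ.front (.disp i) T) (.disp i) :=
  if_pos h

theorem active_of_ne_null {b : Agent n} {T : ℕ} (h : ρ.ev T b ≠ .null) : ρ.Active b T := by
  by_contra ha
  exact h (ρ.ev_of_not_active ha)

theorem ev_eq_of_memVar {b : Agent n} {T : ℕ} {x : Var} (h : (ρ.ev T b).memVar = some x) :
    ρ.Active b T ∧ ρ.ev T b = r.ev (ρ.front b T) b := by
  have ha : ρ.Active b T := ρ.active_of_ne_null fun h0 => by simp [h0, Event.memVar] at h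
  refine ⟨ha, ?_⟩
  cases b with
  | proc i =>
    rw [ρ.ev_proc ha] at h ⊢
    exact Event.resource_eq_of_memVar _ _ h
  | disp i => exact ρ.ev_disp ha

theorem modVal_ev {b : Agent n} {T : ℕ} (x : Var) (h : ρ.Active b T) :
    modVal x b (ρ.ev T b) = modVal x b (r.ev (ρ.front b T) b) := by
  cases b with
  | proc i => rw [ρ.ev_proc h, modVal_resource]
  | disp i => rw [ρ.ev_disp h]

theorem modVal_ev_of_not_active {b : Agent n} {T : ℕ} (x : Var) (h : ¬ ρ.Active b T) :
    modVal x b (ρ.ev T b) = none := by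
  rw [ρ.ev_of_not_active h]
  cases b <;> rfl

theorem isProp_ev {i : Fin n} {T : ℕ} :
    (ρ.ev T (.disp i)).isProp = true ↔
      ρ.Active (.disp i) T ∧ (r.ev (ρ.front (.disp i) T) (.disp i)).isProp = true := by
  by_cases ha : ρ.Active (.disp i) T
  · rw [ρ.ev_disp ha, and_iff_right ha]
  · simp [ρ.ev_of_not_active ha, ha, Event.isProp]

theorem numProps_run (i : Fin n) (T : ℕ) :
    ρ.run.numProps i T = r.numProps i (ρ.front (.disp i) T) :=
  ρ.count_eq (fun _ => ρ.isProp_ev) T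

/-- A memory access of the new run is the same event in `r`, and by `time_eq` simultaneous ones come
from one round of `r`. -/
theorem no_conflict {P : Protocol n Var Val Op Intl} (hr : r.IsRunOf P) (T : ℕ) (b c : Agent n)
    (hbc : b ≠ c) : ¬ Conflicting b (ρ.ev T b) c (ρ.ev T c) := by
  intro h
  obtain ⟨-, ⟨x, hx, hx'⟩, -⟩ := id h
  obtain ⟨ha, hb⟩ := ρ.ev_eq_of_memVar hx
  obtain ⟨ha', hc⟩ := ρ.ev_eq_of_memVar hx'
  have ht : ρ.front b T = ρ.front c T := ρ.time_eq (ha.trans ha'.symm)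
  rw [hb, hc, ← ht] at h
  exact hr.no_conflict _ b c hbc h

/-- The nodes that change `x` and are scheduled before `T` are the ones that take place in `r`
before `u`. -/
def IsMemTime (T : ℕ) (x : Var) (u : ℕ) : Prop :=
  ∀ b t, modVal x b (r.ev t b) ≠ none → (ρ.pos b t < T ↔ t < u)

/-! ### The rescheduled run obeys the laws of TSO -/

section IsRunOf

variable {P : Protocol n Var Val Op Intl}

open Classical in
theorem isMemTime_memTime (hr : r.IsRunOf P) (T : ℕ) (x : Var) :
    ρ.IsMemTime T x (ρ.memTime T x) := by
  intro b t hb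
  have hspec := Nat.find_spec (ρ.exists_memTime T x)
  constructor
  · intro hlt
    by_contra! h
    exact absurd (hspec b t h hb) (not_le.2 hlt)
  · intro hlt
    -- By minimality, some modification of `x` at time `memTime - 1` or later is scheduled before
    -- `T`; the given one either occurs before it or coincides with it.
    have hmin := Nat.find_min (ρ.exists_memTime T x) (m := ρ.memTime T x - 1)
      (Nat.sub_lt (Nat.zero_lt_of_lt hlt) Nat.one_pos)
    push Not at hmin
    obtain ⟨c, t', ht', hc, hpos⟩ := hmin
    rcases Nat.lt_or_ge t t' with h | h
    · exact (ρ.pos_lt (Run.occursBefore_of_modVal h hb hc)).trans hpos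
    · obtain rfl : t = t' := by omega
      rwa [hr.modVal_unique hb hc]

theorem IsMemTime.mem_eq {ρ : Reordering r} (hr : r.IsRunOf P) {T u u' : ℕ} {x : Var}
    (h : ρ.IsMemTime T x u) (h' : ρ.IsMemTime T x u') :
    (r.state u).tso.mem x = (r.state u').tso.mem x := by
  have key : ∀ {u u' : ℕ}, ρ.IsMemTime T x u → ρ.IsMemTime T x u' → u ≤ u' →
      (r.state u').tso.mem x = (r.state u).tso.mem x := by
    intro u u' h h' huu
    refine hr.mem_eq_of_no_mod huu fun w h1 h2 b => ?_
    by_contra hb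
    exact absurd ((h b w hb).1 ((h' b w hb).2 h2)) (not_lt.2 h1)
  rcases le_total u u' with huu | huu
  · exact (key h h' huu).symm
  · exact key h' h huu

/-- This frees later arguments from `memTime`: any separating time will do, for instance the
original time of a read. -/
theorem run_mem_eq (hr : r.IsRunOf P) {T u : ℕ} {x : Var} (h : ρ.IsMemTime T x u) :
    (ρ.run.state T).tso.mem x = (r.state u).tso.mem x :=
  (ρ.isMemTime_memTime hr T x).mem_eq hr h

/-- Items are not propagated before they are written. -/
theorem numProps_lt_length_writes (hr : r.IsRunOf P) {i : Fin n} {t T : ℕ}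
    (h : (r.ev t (.disp i)).isProp = true) (hT : ρ.pos (.disp i) t ≤ T) :
    r.numProps i t < (r.writes i (ρ.front (.proc i) T)).length := by
  obtain ⟨t₀, hob, hlt⟩ := hr.exists_write_occursBefore h
  have h₀ : t₀ + 1 ≤ ρ.front (.proc i) T := ρ.lt_front.2 ((ρ.pos_lt hob).trans_le hT)
  exact hlt.trans_le (r.writes_prefix i h₀).length_le

theorem numProps_le_length_writes (hr : r.IsRunOf P) (i : Fin n) (T : ℕ) :
    r.numProps i (ρ.front (.disp i) T) ≤ (r.writes i (ρ.front (.proc i) T)).length := by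
  rcases Nat.eq_zero_or_pos (r.numProps i (ρ.front (.disp i) T)) with h | h
  · omega
  · obtain ⟨t, ht, hp, hk⟩ := exists_count_eq (Nat.sub_lt h Nat.one_pos)
    have := ρ.numProps_lt_length_writes hr hp (ρ.lt_front.1 ht).le
    change r.numProps i t = r.numProps i _ - 1 at hk
    omega

theorem step_buf (hr : r.IsRunOf P) (i : Fin n) (T : ℕ) :
    ρ.buf i (T + 1) =
      if (ρ.ev T (.disp i)).isProp = true then (ρ.buf i T ++ (ρ.ev T (.proc i)).written).tail
      else ρ.buf i T ++ (ρ.ev T (.proc i)).written := by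
  have hle := ρ.numProps_le_length_writes hr i T
  have hw : r.writes i (ρ.front (.proc i) (T + 1)) =
      r.writes i (ρ.front (.proc i) T) ++ (ρ.ev T (.proc i)).written := by
    by_cases ha : ρ.Active (.proc i) T
    · rw [ρ.front_succ_of_active ha, Run.writes_succ, ρ.ev_proc ha, Event.resource_written]
    · rw [ρ.front_succ_of_not_active ha, ρ.ev_of_not_active ha]
      simp [Event.written]
  have hp : r.numProps i (ρ.front (.disp i) (T + 1)) = r.numProps i (ρ.front (.disp i) T) +
      if (ρ.ev T (.disp i)).isProp = true then 1 else 0 := by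
    rw [← numProps_run, ← numProps_run, Run.numProps, Nat.count_succ]
    rfl
  rw [buf, buf, hw, hp, ← List.drop_append_of_le_length hle]
  split_ifs
  · rw [List.tail_drop]
  · rfl

/-- If nothing modifies `x` at `T`, a separating time for `T` also serves `T + 1`. Otherwise the
modification is unique, and the time right after it in `r` separates. -/
theorem step_mem (hr : r.IsRunOf P) (T : ℕ) (x : Var) :
    (ρ.run.state (T + 1)).tso.mem x = (jointEffect (ρ.run.state T).tso (ρ.ev T)).mem x := by
  by_cases hno : ∀ b, modVal x b (ρ.ev T b) = none
  · rw [jointEffect_mem_of_none _ _ _ hno, ρ.run_mem_eq hr (ρ.isMemTime_memTime hr T x)]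
    refine ρ.run_mem_eq hr fun b t hb => ?_
    rw [← ρ.isMemTime_memTime hr T x b t hb, Nat.lt_succ_iff, le_iff_lt_or_eq,
      or_iff_left_iff_imp]
    intro hT
    have hf := ρ.front_eq hT
    have ha : ρ.Active b T := by rw [Active, hf, hT]
    have := hno b
    rw [ρ.modVal_ev x ha, hf] at this
    exact absurd this hb
  · push Not at hno
    obtain ⟨b, hb⟩ := hno
    obtain ⟨v, hv⟩ := Option.ne_none_iff_exists'.1 hb
    have ha : ρ.Active b T := by
      by_contra ha
      exact hb (ρ.modVal_ev_of_not_active x ha)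
    rw [jointEffect_mem_of_some _ _ x b v hv fun c hc => by
      by_contra h
      exact ρ.no_conflict hr T c b hc (conflicting_of_modVal h hb)]
    rw [ρ.modVal_ev x ha] at hv
    rw [← hr.mem_succ_of_modVal hv]
    have hb' : modVal x b (r.ev (ρ.front b T) b) ≠ none := by simp [hv]
    refine ρ.run_mem_eq hr fun c t hc => ?_
    rw [Nat.lt_succ_iff, Nat.lt_succ_iff]
    rcases lt_trichotomy t (ρ.front b T) with h | h | h
    · have := ρ.pos_lt (Run.occursBefore_of_modVal h hc hb')
      exact iff_of_true (by rw [ha] at this; exact this.le) h.le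
    · subst h
      obtain rfl := hr.modVal_unique hc hb'
      exact iff_of_true ha.le le_rfl
    · have := ρ.pos_lt (Run.occursBefore_of_modVal h hb' hc)
      exact iff_of_false (by rw [ha] at this; exact not_le.2 this) (not_le.2 h)

theorem step_tso (hr : r.IsRunOf P) (T : ℕ) :
    (ρ.run.state (T + 1)).tso = jointEffect (ρ.run.state T).tso (ρ.run.ev T) := by
  have hm : (ρ.run.state (T + 1)).tso.mem = (jointEffect (ρ.run.state T).tso (ρ.ev T)).mem :=
    funext fun x => ρ.step_mem hr T x
  have hb : (ρ.run.state (T + 1)).tso.buf = (jointEffect (ρ.run.state T).tso (ρ.ev T)).buf := by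
    funext i
    rw [jointEffect_buf]
    exact ρ.step_buf hr i T
  change _ = jointEffect (ρ.run.state T).tso (ρ.ev T)
  revert hm hb
  generalize (ρ.run.state (T + 1)).tso = σ
  generalize jointEffect (ρ.run.state T).tso (ρ.ev T) = σ'
  intro hm hb
  cases σ
  cases σ'
  simp_all

/-- In `r` everything written before the fence or RMW has been propagated, and by the fence clause
these propagations stay before it. -/
theorem buf_eq_nil_of_fence (hr : r.IsRunOf P) {i : Fin n} {T : ℕ} (ha : ρ.Active (.proc i) T)
    (hf : (r.ev (ρ.front (.proc i) T) (.proc i)).isFenceOrRMW = true)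
    (hnil : (r.state (ρ.front (.proc i) T)).tso.buf i = []) : ρ.buf i T = [] := by
  rw [(hr.buf_eq i _).1, List.drop_eq_nil_iff] at hnil
  rw [buf, List.drop_eq_nil_iff]
  refine hnil.trans ?_
  by_contra! hlt
  obtain ⟨t, ht, hp, hk⟩ := exists_count_eq hlt
  have hpos := ρ.pos_lt (.fence i t _ ht hp hf)
  rw [ha] at hpos
  have := r.numProps_lt hp (ρ.lt_front.2 hpos)
  rw [Run.numProps, hk] at this
  exact lt_irrefl _ this

/-- The process has made the same writes as in `r`, so it suffices that the item read has not yet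
left the buffer. Its propagation is not earlier than the read in `r`, not simultaneous by `hsep`,
and if later, then ordered after the read by the buffer clause. -/
theorem restrict_buf_of_rfb (hr : r.IsRunOf P) (hsep : r.BufferReadsSeparate) {i : Fin n} {T : ℕ}
    {x : Var} {v : Val} (ha : ρ.Active (.proc i) T)
    (he : r.ev (ρ.front (.proc i) T) (.proc i) = .rfb x v) :
    (restrict (ρ.buf i T) x).getLast? = some (x, v) := by
  have hen := hr.enabled (ρ.front (.proc i) T) (.proc i)
  rw [he, Enabled] at hen
  obtain ⟨-, β₁, β₂, hβ, hlast⟩ := exists_split_of_restrict hen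
  have hrfb : (r.ev (ρ.front (.proc i) T) (.proc i)).isRfB = true := by rw [he]; rfl
  have htag := Run.HasTag.rfb i (ρ.front (.proc i) T) x v β₁ β₂ he hβ hlast
  obtain ⟨hbuf, hle⟩ := hr.buf_eq i (ρ.front (.proc i) T)
  have hW : r.writes i (ρ.front (.proc i) T) =
      ((r.writes i (ρ.front (.proc i) T)).take (r.numProps i (ρ.front (.proc i) T)) ++ β₁) ++
        (x, v) :: β₂ := by
    rw [List.append_assoc, ← hβ, hbuf, List.take_append_drop]
  have hq : r.numProps i (ρ.front (.disp i) T) ≤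
      r.numProps i (ρ.front (.proc i) T) + β₁.length := by
    refine ρ.numProps_le_of_forall fun t hp hk => ?_
    obtain ⟨y, w, hy⟩ := Event.exists_of_isProp hp
    have htag' := Run.HasTag.prop i t y w hy
    rw [hk] at htag'
    rcases lt_trichotomy t (ρ.front (.proc i) T) with h | h | h
    · have := r.numProps_lt hp h
      omega
    · subst h
      exact absurd htag' (hsep i _ _ hrfb htag)
    · have := ρ.pos_lt (.buffer i _ t _ h (Or.inr hrfb) hp htag htag')
      rw [ha] at this
      exact this.le
  rw [buf, hW, List.drop_append_of_le_length
    (by simp only [List.length_append, List.length_take]; omega)]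
  exact restrict_getLast?_of_split hlast

/-- The original time of the read separates the modifications of `x`. Only propagations by `d_i`
that precede the read are not covered by occurs-before; for these the empty `restrict` helps. -/
theorem mem_of_rfm (hr : r.IsRunOf P) {i : Fin n} {T : ℕ}
    {x : Var} {v : Val} (ha : ρ.Active (.proc i) T)
    (he : r.ev (ρ.front (.proc i) T) (.proc i) = .rfm x v) (hnil : restrict (ρ.buf i T) x = []) :
    (ρ.run.state T).tso.mem x = v := by
  have hen := hr.enabled (ρ.front (.proc i) T) (.proc i)
  rw [he, Enabled] at hen
  obtain ⟨hnil₀, hmem⟩ := hen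
  rw [← hmem]
  refine ρ.run_mem_eq hr fun b t hb => ?_
  obtain ⟨hv, hm⟩ := memVar_of_modVal hb
  rcases lt_trichotomy t (ρ.front (.proc i) T) with h | h | h
  · refine iff_of_true ?_ h
    by_cases hbi : b = .disp i
    · subst hbi
      obtain ⟨w, hw⟩ := Option.ne_none_iff_exists'.1 hb
      have hprop : r.ev t (.disp i) = .prop x w := by
        rcases modVal_eq_some hw with ⟨j, a, hj, -⟩ | ⟨j, -, hj⟩
        · cases hj
        · exact hj
      have hitem := hr.writes_getElem?_of_prop hprop
      obtain ⟨l, hl⟩ := r.writes_prefix i h.le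
      -- Were the propagation postponed to `T` or later, its item for `x` would still be in the new
      -- buffer.
      by_contra hpos
      have hfr : ρ.front (.disp i) T ≤ t := not_lt.1 fun h' => hpos (ρ.lt_front.1 h')
      refine restrict_eq_nil.1 hnil (x, w) ?_ rfl
      rw [buf, ← hl]
      refine List.mem_of_getElem? (i := r.numProps i t - r.numProps i (ρ.front (.disp i) T)) ?_
      rw [List.getElem?_drop, Nat.add_sub_cancel' (r.numProps_mono i hfr),
        List.getElem?_append_left (List.getElem?_eq_some_iff.1 hitem).1, hitem]
    · have := ρ.pos_lt (.memory b (.proc i) t _ x h hv (by rw [he]; rfl) (by simp [hm]) (by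
        rintro ⟨j, hj, hj', -⟩
        cases hj'
        exact hbi hj))
      rwa [ha] at this
  · subst h
    refine iff_of_false (fun _ => ?_) (lt_irrefl _)
    have hne : b ≠ .proc i := by
      rintro rfl
      rw [he] at hm
      simp [Event.isRfM] at hm
    refine hr.no_conflict _ b (.proc i) hne ⟨by simp [hm], ⟨x, hv, by rw [he]; rfl⟩, ?_⟩
    rintro ⟨j, ⟨hj, hp, hj', -⟩ | ⟨hj, -⟩⟩
    · cases hj'
      subst hj
      -- A simultaneous `prop` by `d_i` is exempt from conflict, but its item heads the buffer in
      -- `r`, where `i` could then not read `x` from memory.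
      obtain ⟨y, w, hy⟩ := Event.exists_of_isProp hp
      rw [hy] at hv
      have hen := hr.enabled (ρ.front (.proc i) T) (.disp i)
      rw [hy, Enabled] at hen
      exact restrict_eq_nil.1 hnil₀ _ (List.mem_of_head? hen) (by simpa [Event.memVar] using hv)
    · cases hj
  · refine iff_of_false ?_ h.le.not_gt
    have := ρ.pos_lt (.memory (.proc i) b _ t x h (by rw [he]; rfl) hv (by simp [hm]) (by simp))
    rw [ha] at this
    exact this.le.not_gt

/-- The latest buffered item for the variable had already been propagated in `r` when the read took
place. No other modification came in between, so memory held its value. -/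
theorem restrict_buf_of_rfm (hr : r.IsRunOf P) {i : Fin n} {T : ℕ}
    {x : Var} {v : Val} (ha : ρ.Active (.proc i) T)
    (he : r.ev (ρ.front (.proc i) T) (.proc i) = .rfm x v) (hnil : restrict (ρ.buf i T) x ≠ []) :
    (restrict (ρ.buf i T) x).getLast? = some (x, v) := by
  have hen := hr.enabled (ρ.front (.proc i) T) (.proc i)
  rw [he, Enabled, (hr.buf_eq i _).1] at hen
  obtain ⟨hnil₀, hmem⟩ := hen
  obtain ⟨⟨y, w⟩, hlast⟩ := Option.ne_none_iff_exists'.1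
    (mt List.getLast?_eq_none_iff.1 hnil)
  rw [hlast]
  obtain ⟨hy, β₁, β₂, hβ, hβ₂⟩ := exists_split_of_restrict hlast
  change y = x at hy
  subst hy
  suffices hw : (r.state (ρ.front (.proc i) T)).tso.mem y = w by rw [← hw, hmem]
  set q := r.numProps i (ρ.front (.disp i) T) with hq
  have hitem : (r.writes i (ρ.front (.proc i) T))[q + β₁.length]? = some (y, w) := by
    rw [← List.getElem?_drop]
    rw [buf, ← hq] at hβ
    simp [hβ]
  -- The item has number `q + β₁.length` among the writes of `i`, and it is the last one for `y`
  -- before the read.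
  have hafter : ∀ k z, q + β₁.length < k →
      (r.writes i (ρ.front (.proc i) T))[k]? ≠ some (y, z) := by
    intro k z hk hz
    obtain ⟨m, rfl⟩ : ∃ m, k = q + (β₁.length + 1 + m) := ⟨k - (q + β₁.length + 1), by omega⟩
    rw [← List.getElem?_drop] at hz
    rw [buf, ← hq] at hβ
    rw [hβ, List.getElem?_append_right (by omega), show β₁.length + 1 + m - β₁.length = m + 1 by
      omega, List.getElem?_cons_succ] at hz
    exact hβ₂ _ (List.mem_of_getElem? hz) rfl
  -- Otherwise the item would still be buffered in `r`, and the read would not have gone to memory.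
  have hkp : q + β₁.length < r.numProps i (ρ.front (.proc i) T) := by
    by_contra! hge
    refine restrict_eq_nil.1 hnil₀ (y, w) ?_ rfl
    refine List.mem_of_getElem?
      (i := q + β₁.length - r.numProps i (ρ.front (.proc i) T)) ?_
    rw [List.getElem?_drop, Nat.add_sub_cancel' hge, hitem]
  obtain ⟨t, ht, hp, hk⟩ := exists_count_eq hkp
  change r.numProps i t = _ at hk
  obtain ⟨z, z', hz⟩ := Event.exists_of_isProp hp
  have hitem' := hr.writes_getElem?_of_prop hz
  have hzz := r.writes_getElem?_of_lt i (t' := ρ.front (.proc i) T) hitem'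
    (by rw [hk]; exact (List.getElem?_eq_some_iff.1 hitem).1)
  rw [hk, hitem] at hzz
  obtain ⟨rfl, rfl⟩ : y = z ∧ w = z' := by simpa using hzz
  have hmod : modVal y (.disp i) (r.ev t (.disp i)) = some w := by rw [hz]; simp [modVal]
  rw [← hr.mem_succ_of_modVal hmod]
  refine hr.mem_eq_of_no_mod ht fun u h1 h2 b => ?_
  by_contra hb
  obtain ⟨hv, hm⟩ := memVar_of_modVal hb
  by_cases hbi : b = .disp i
  · subst hbi
    obtain ⟨w', hw'⟩ := Option.ne_none_iff_exists'.1 hb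
    have hprop : r.ev u (.disp i) = .prop y w' := by
      rcases modVal_eq_some hw' with ⟨j, a, hj, -⟩ | ⟨j, -, hj⟩
      · cases hj
      · exact hj
    have hu := hr.writes_getElem?_of_prop hprop
    have hlt : q + β₁.length < r.numProps i u := hk ▸ r.numProps_lt hp h1
    obtain ⟨l, hl⟩ := r.writes_prefix i h2.le
    refine hafter _ w' hlt ?_
    rw [← hl, List.getElem?_append_left (List.getElem?_eq_some_iff.1 hu).1, hu]
  -- A modification by another agent would link the propagation to the read in occurs-before. The
  -- propagation would then be scheduled before `T`, and its item would be gone.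
  · have hob := Run.OccursBefore.trans _ _ _ 
      (Run.occursBefore_of_modVal (b := .disp i) h1 (by simp [hmod]) hb)
      (.memory b (.proc i) u _ y h2 hv (by rw [he]; rfl) (by simp [hm]) (by
        rintro ⟨j, hj, hj', -⟩
        cases hj'
        exact hbi hj))
    have hpos := ρ.pos_lt hob
    rw [ha] at hpos
    have := r.numProps_lt hp (ρ.lt_front.2 hpos)
    omega

theorem mem_of_rmw (hr : r.IsRunOf P) {i : Fin n} {T : ℕ}
    {x : Var} {v w : Val} (ha : ρ.Active (.proc i) T)
    (he : r.ev (ρ.front (.proc i) T) (.proc i) = .rmw x v w) :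
    (ρ.run.state T).tso.mem x = v := by
  have hen := hr.enabled (ρ.front (.proc i) T) (.proc i)
  rw [he, Enabled] at hen
  rw [← hen.2]
  have hi : modVal x (.proc i) (r.ev (ρ.front (.proc i) T) (.proc i)) ≠ none := by
    simp [he, modVal]
  refine ρ.run_mem_eq hr fun b t hb => ?_
  rcases lt_trichotomy t (ρ.front (.proc i) T) with h | h | h
  · have := ρ.pos_lt (Run.occursBefore_of_modVal h hb hi)
    rw [ha] at this
    exact iff_of_true this h
  · subst h
    obtain rfl := hr.modVal_unique hb hi
    exact iff_of_false ha.ge.not_gt (lt_irrefl _)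
  · have := ρ.pos_lt (Run.occursBefore_of_modVal h hi hb)
    rw [ha] at this
    exact iff_of_false this.le.not_gt h.le.not_gt

theorem enabled_run (hr : r.IsRunOf P) (hsep : r.BufferReadsSeparate) (T : ℕ) (b : Agent n) :
    Enabled (ρ.run.state T).tso b (ρ.ev T b) := by
  by_cases ha : ρ.Active b T
  · have hen := hr.enabled (ρ.front b T) b
    cases b with
    | proc i =>
      rw [ρ.ev_proc ha]
      cases he : r.ev (ρ.front (.proc i) T) (.proc i) with
      | rfm x v =>
        rw [Event.resource]
        split_ifs with hemp
        · rw [List.isEmpty_iff] at hemp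
          exact ⟨hemp, ρ.mem_of_rfm hr ha he hemp⟩
        · rw [List.isEmpty_iff] at hemp
          exact ρ.restrict_buf_of_rfm hr ha he hemp
      | rfb x v => exact ρ.restrict_buf_of_rfb hr hsep ha he
      | fence =>
        rw [he] at hen
        exact ρ.buf_eq_nil_of_fence hr ha (by rw [he]; rfl) hen
      | rmw x v w =>
        rw [he] at hen
        exact ⟨ρ.buf_eq_nil_of_fence hr ha (by rw [he]; rfl) hen.1, ρ.mem_of_rmw hr ha he⟩
      | prop x v =>
        rw [he] at hen
        exact hen.elim
      | _ => trivial
    | disp i =>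
      rw [ρ.ev_disp ha]
      cases he : r.ev (ρ.front (.disp i) T) (.disp i) with
      | null => trivial
      | prop x v =>
        change (ρ.buf i T).head? = _
        rw [buf, List.head?_drop]
        exact r.writes_getElem?_of_lt i (hr.writes_getElem?_of_prop he)
          (ρ.numProps_lt_length_writes hr (by rw [he]; rfl) ha.le)
      | _ =>
        rw [he] at hen
        exact hen.elim
  · rw [ρ.ev_of_not_active ha]
    cases b <;> trivial

theorem run_inv_eq_some {i : Fin n} {T : ℕ} {O : Op} :
    ρ.run.inv T i = some O ↔
      ρ.Active (.proc i) T ∧ r.inv (ρ.front (.proc i) T) i = some O := by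
  change (if _ then _ else _) = _ ↔ _
  split_ifs with h
  · rw [and_iff_right h]
  · simp [h]

theorem run_inv_of_pos {i : Fin n} {t : ℕ} :
    ρ.run.inv (ρ.pos (.proc i) t) i = r.inv t i := by
  have hf := ρ.front_eq (b := .proc i) (t := t) rfl
  change (if ρ.Active _ _ then _ else _) = _
  rw [if_pos (show ρ.Active _ _ by rw [Active, hf]), hf]

theorem ev_eq_ret {i : Fin n} {T : ℕ} {O : Op} :
    ρ.ev T (.proc i) = .ret O ↔
      ρ.Active (.proc i) T ∧ r.ev (ρ.front (.proc i) T) (.proc i) = .ret O := by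
  by_cases ha : ρ.Active (.proc i) T
  · rw [ρ.ev_proc ha, Event.resource_eq_ret, and_iff_right ha]
  · simp [ρ.ev_of_not_active ha, ha]

theorem ev_pos_eq_ret {i : Fin n} {t : ℕ} {O : Op} :
    ρ.ev (ρ.pos (.proc i) t) (.proc i) = .ret O ↔ r.ev t (.proc i) = .ret O := by
  rw [ev_eq_ret, Active, ρ.front_eq rfl]
  simp

theorem isRunOf_run (hr : r.IsRunOf P) (hsep : r.BufferReadsSeparate) : ρ.run.IsRunOf P where
  init_buf i := by
    change ρ.buf i 0 = []
    simp [buf, front_zero, Run.writes]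
  init_loc i := by
    change (r.state (ρ.front (.proc i) 0)).loc i = []
    rw [front_zero, hr.init_loc]
  enabled := ρ.enabled_run hr hsep
  no_conflict := ρ.no_conflict hr
  step_tso := ρ.step_tso hr
  step_loc T i := by
    change (r.state (ρ.front (.proc i) (T + 1))).loc i = (r.state (ρ.front (.proc i) T)).loc i ++
      (ρ.ev T (.proc i)).record ++ (Option.map _ (if _ then _ else _)).toList
    by_cases ha : ρ.Active (.proc i) T
    · rw [ρ.front_succ_of_active ha, hr.step_loc, ρ.ev_proc ha, Event.resource_record, if_pos ha]
    · rw [ρ.front_succ_of_not_active ha, ρ.ev_of_not_active ha, if_neg ha]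
      simp [Event.record]
  follows T i h := by
    change ρ.ev T (.proc i) ≠ .null at h
    have ha := ρ.active_of_ne_null h
    change ∃ a ∈ P.acts i ((r.state (ρ.front (.proc i) T)).loc i), (ρ.ev T (.proc i)).action = _
    rw [ρ.ev_proc ha] at h ⊢
    rw [Event.resource_action]
    exact hr.follows _ i (mt (Event.resource_eq_null _ _).2 h)
  one_pending i O T T' hTT h h' := by
    obtain ⟨O', hO'⟩ := Option.ne_none_iff_exists'.1 h'
    obtain ⟨ha, h⟩ := ρ.run_inv_eq_some.1 h
    obtain ⟨ha', hO'⟩ := ρ.run_inv_eq_some.1 hO'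
    have hlt : ρ.front (.proc i) T < ρ.front (.proc i) T' := by
      rw [lt_front, ha]
      exact hTT
    obtain ⟨τ, h1, h2, h3⟩ := hr.one_pending i O _ _ hlt h (by simp [hO'])
    refine ⟨ρ.pos (.proc i) τ, ?_, ?_, ρ.ev_pos_eq_ret.2 h3⟩
    · have := ρ.pos_strictMono (.proc i) h1
      rwa [ha] at this
    · have := (ρ.pos_strictMono (.proc i)).monotone h2
      rwa [ha'] at this

/-- If `i` reads while `d_i` propagates, both nodes come from one round of `r`, so the buffer is the
one in `r`. Hence the read was from the buffer there too, and `hsep` applies. -/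
theorem bufferReadsSeparate_run (hr : r.IsRunOf P) (hsep : r.BufferReadsSeparate) :
    ρ.run.BufferReadsSeparate := by
  intro i T κ hrfb htag htag'
  obtain ⟨x, v, he⟩ := Event.exists_of_isRfB hrfb
  change ρ.ev T (.proc i) = _ at he
  have ha : ρ.Active (.proc i) T := ρ.active_of_ne_null (by simp [he])
  cases htag' with
  | prop _ _ y w hy =>
    change ρ.ev T (.disp i) = _ at hy
    have ha' : ρ.Active (.disp i) T := ρ.active_of_ne_null (by simp [hy])
    have ht : ρ.front (.disp i) T = ρ.front (.proc i) T := ρ.time_eq (ha'.trans ha.symm)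
    have hbuf : ρ.buf i T = (r.state (ρ.front (.proc i) T)).tso.buf i := by
      rw [buf, ht, (hr.buf_eq i _).1]
    rw [ρ.ev_disp ha', ht] at hy
    have hprop := Run.HasTag.prop i _ y w hy
    have hrb : r.ev (ρ.front (.proc i) T) (.proc i) = .rfb x v := by
      rw [ρ.ev_proc ha] at he
      cases he' : r.ev (ρ.front (.proc i) T) (.proc i) with
      | rfm z z' =>
        have hen := hr.enabled (ρ.front (.proc i) T) (.proc i)
        rw [he', Enabled, ← hbuf] at hen
        rw [he', Event.resource, hen.1] at he
        simp at he
      | _ => simp_all [Event.resource]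
    generalize hκ : (i, ρ.run.numProps i T) = κ at htag
    cases htag with
    | write _ _ x' v' h' =>
      change ρ.ev T (.proc i) = _ at h'
      simp [he] at h'
    | rfb _ _ x' v' β₁ β₂ h' hβ hlast =>
      change ρ.ev T (.proc i) = _ at h'
      obtain ⟨rfl, rfl⟩ : x = x' ∧ v = v' := by simpa [he] using h'
      change ρ.buf i T = _ at hβ
      rw [hbuf] at hβ
      have := Run.HasTag.rfb i _ x v β₁ β₂ hrb hβ hlast
      refine hsep i _ _ (by rw [hrb]; rfl) this ?_
      have h0 : β₁.length = 0 := by simpa using hκ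
      rw [h0]
      exact hprop

theorem locallyEquivalent_run : r.LocallyEquivalent ρ.run := by
  intro j l
  constructor
  · rintro ⟨t, rfl⟩
    refine ⟨ρ.pos (.proc j) t, ?_⟩
    change (r.state (ρ.front (.proc j) _)).loc j = _
    rw [ρ.front_eq rfl]
  · rintro ⟨T, rfl⟩
    exact ⟨ρ.front (.proc j) T, rfl⟩

theorem run_state_zero (hr : r.IsRunOf P) : ρ.run.state 0 = r.state 0 := by
  have hm : (ρ.run.state 0).tso.mem = (r.state 0).tso.mem :=
    funext fun x => ρ.run_mem_eq hr fun b t _ => by simp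
  have hb : (ρ.run.state 0).tso.buf = (r.state 0).tso.buf := by
    funext i
    rw [hr.init_buf]
    change ρ.buf i 0 = []
    simp [buf, front_zero, Run.writes]
  have hl : (ρ.run.state 0).loc = (r.state 0).loc := by
    funext i
    change (r.state (ρ.front (.proc i) 0)).loc i = _
    rw [front_zero]
  revert hm hb hl
  generalize ρ.run.state 0 = g
  generalize r.state 0 = g'
  rcases g with ⟨⟨_, _⟩, _⟩
  rcases g' with ⟨⟨_, _⟩, _⟩
  rintro ⟨⟩ ⟨⟩ ⟨⟩
  rfl

theorem occursBetween_run {X : Operation n Op} {s τ : ℕ} (hX : X.OccursBetween r s (τ + 1)) :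
    X.OccursBetween ρ.run (ρ.pos (.proc X.proc) s) (ρ.pos (.proc X.proc) τ + 1) := by
  obtain ⟨hinv, hcount, τ', hs, he, hret, hfirst⟩ := hX
  obtain rfl : τ = τ' := by omega
  refine ⟨?_, ?_, ρ.pos (.proc X.proc) τ, ρ.pos_strictMono _ hs, rfl, ρ.ev_pos_eq_ret.2 hret, ?_⟩
  · rw [run_inv_of_pos, hinv]
  · rw [← hcount, ρ.count_eq (b := .proc X.proc) (p := fun t => (r.inv t X.proc).isSome = true),
      ρ.front_eq rfl]
    intro T
    change (if _ then _ else _ : Option Op).isSome = true ↔ _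
    split_ifs with h
    · rw [and_iff_right h]
    · simp [h]
  · intro T h1 h2 h
    obtain ⟨ha, h⟩ := ρ.ev_eq_ret.1 h
    rw [← ha, (ρ.pos_strictMono _).lt_iff_lt] at h1 h2
    exact hfirst _ h1 h2 h

end IsRunOf

end Reordering

/-! ### Fairness of reschedulings that are eventually a constant delay -/

namespace Reordering

variable {r : Run n Var Val Op Intl} (ρ : Reordering r)

/-- From time `K` of `r` on, the rescheduling only delays all nodes by `D`. -/
def IsShiftFrom (D K : ℕ) : Prop := ∀ b t, K ≤ t → ρ.pos b t = D + t

namespace IsShiftFrom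

variable {ρ} {D K : ℕ}

theorem front_add (h : ρ.IsShiftFrom D K) (b : Agent n) {t : ℕ} (ht : K ≤ t) :
    ρ.front b (D + t) = t :=
  ρ.front_eq (h b t ht)

theorem active_add (h : ρ.IsShiftFrom D K) (b : Agent n) {t : ℕ} (ht : K ≤ t) :
    ρ.Active b (D + t) := by
  rw [Active, h.front_add b ht, h b t ht]

variable [DecidableEq Var] {P : Protocol n Var Val Op Intl}

theorem run_buf_add (h : ρ.IsShiftFrom D K) (hr : r.IsRunOf P) (i : Fin n) {t : ℕ} (ht : K ≤ t) :
    (ρ.run.state (D + t)).tso.buf i = (r.state t).tso.buf i := by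
  change ρ.buf i (D + t) = _
  rw [buf, h.front_add _ ht, h.front_add _ ht, (hr.buf_eq i t).1]

theorem run_mem_add (h : ρ.IsShiftFrom D K) (hr : r.IsRunOf P) (x : Var) {t : ℕ} (ht : K ≤ t) :
    (ρ.run.state (D + t)).tso.mem x = (r.state t).tso.mem x :=
  ρ.run_mem_eq hr fun b u _ => by rw [← lt_front, h.front_add b ht]

theorem run_tso_add (h : ρ.IsShiftFrom D K) (hr : r.IsRunOf P) {t : ℕ} (ht : K ≤ t) :
    (ρ.run.state (D + t)).tso = (r.state t).tso := by
  have hm := funext fun x => h.run_mem_add hr x ht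
  have hb := funext fun i => h.run_buf_add hr i ht
  generalize (ρ.run.state (D + t)).tso = σ at hm hb
  generalize (r.state t).tso = σ' at hm hb
  cases σ
  cases σ'
  simp_all

theorem canMove_iff (h : ρ.IsShiftFrom D K) (hr : r.IsRunOf P) (i : Fin n) {t : ℕ} (ht : K ≤ t) :
    ρ.run.CanMove P i (D + t) ↔ r.CanMove P i t := by
  have hloc : (ρ.run.state (D + t)).loc i = (r.state t).loc i := by
    change (r.state (ρ.front (.proc i) (D + t))).loc i = _
    rw [h.front_add _ ht]
  rw [Run.CanMove, Run.CanMove, h.run_tso_add hr ht, hloc]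

theorem procFair (h : ρ.IsShiftFrom D K) (hr : r.IsRunOf P) (hf : r.ProcFair P) :
    ρ.run.ProcFair P := by
  intro i T hT
  obtain ⟨t, ht, hne⟩ := hf i (max K T) fun t ht =>
    (h.canMove_iff hr i ((le_max_left K T).trans ht)).1
      (hT _ (((le_max_right K T).trans ht).trans (Nat.le_add_left t D)))
  have hKt := (le_max_left K T).trans ht
  refine ⟨D + t, ((le_max_right K T).trans ht).trans (Nat.le_add_left t D), ?_⟩
  change ρ.ev (D + t) (.proc i) ≠ .null
  rw [ρ.ev_proc (h.active_add _ hKt), h.front_add _ hKt]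
  exact mt (Event.resource_eq_null _ _).1 hne

theorem propFair (h : ρ.IsShiftFrom D K) (hr : r.IsRunOf P) (hf : r.PropFair) : ρ.run.PropFair := by
  intro i T hT
  by_contra! hno
  have hq : ∀ T', T ≤ T' → ρ.run.numProps i T' = ρ.run.numProps i T := by
    intro T' hT'
    induction T', hT' using Nat.le_induction with
    | base => rfl
    | succ m hm ih =>
      rw [Run.numProps, Nat.count_succ, if_neg (hno m hm), add_zero]
      exact ih
  have hKt : K ≤ K + T := Nat.le_add_right K T
  have hTT : T ≤ D + (K + T) := by omega
  -- Without propagations after `T` the buffer can only grow, so it is still nonempty once the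
  -- constant delay has set in.
  have hne : (r.state (K + T)).tso.buf i ≠ [] := by
    rw [← h.run_buf_add hr i hKt]
    change ρ.buf i _ ≠ []
    change ρ.buf i _ ≠ [] at hT
    have := hq _ hTT
    rw [numProps_run, numProps_run] at this
    rw [buf, Ne, List.drop_eq_nil_iff, not_le] at hT ⊢
    rw [this]
    exact hT.trans_le (r.writes_prefix i (ρ.front_mono _ hTT)).length_le
  obtain ⟨t, ht, hp⟩ := hf i _ hne
  refine hno (D + t) (by omega) ?_
  change (ρ.ev _ _).isProp = true
  rw [ρ.ev_disp (h.active_add _ (hKt.trans ht)), h.front_add _ (hKt.trans ht)]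
  exact hp

end IsShiftFrom

end Reordering

/-! ### The three phases that isolate an operation -/

namespace Run

variable (r : Run n Var Val Op Intl) (i : Fin n) (s e : ℕ)

open Classical in
/-- The phase of a node in the rescheduling that isolates the interval of process `i` from `s` to
`e`: `0` for the nodes that the start does not influence, `1` for the ones that influence the end,
and `2` for all others. -/
noncomputable def phase (θ : Agent n × ℕ) : ℕ :=
  if θ.2 ≤ e ∧ θ ≠ (.proc i, s) ∧ ¬ r.OccursBefore (.proc i, s) θ then 0
  else if r.OccursBefore θ (.proc i, e) then 1
  else 2

/-- Phase `0` and the set of nodes before `⟨i, e⟩` are both closed under predecessors. -/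
theorem phase_le {θ θ' : Agent n × ℕ} (h : r.OccursBefore θ θ') :
    r.phase i s e θ ≤ r.phase i s e θ' := by
  have hA : θ'.2 ≤ e ∧ θ' ≠ (.proc i, s) ∧ ¬ r.OccursBefore (.proc i, s) θ' →
      θ.2 ≤ e ∧ θ ≠ (.proc i, s) ∧ ¬ r.OccursBefore (.proc i, s) θ := by
    rintro ⟨h1, -, h3⟩
    refine ⟨h.time_lt.le.trans h1, ?_, fun h' => h3 (.trans _ _ _ h' h)⟩
    rintro rfl
    exact h3 h
  have hB : r.OccursBefore θ' (.proc i, e) → r.OccursBefore θ (.proc i, e) :=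
    fun h' => .trans _ _ _ h h'
  unfold phase
  split_ifs <;> first | omega | tauto

theorem phase_le_two (θ : Agent n × ℕ) : r.phase i s e θ ≤ 2 := by
  unfold phase
  split_ifs <;> omega

/-- This is why blocks of length `e + 1` suffice for the first two phases. -/
theorem time_le_of_phase_lt {θ : Agent n × ℕ} (h : r.phase i s e θ < 2) : θ.2 ≤ e := by
  unfold phase at h
  split_ifs at h with h1 h2
  · exact h1.1
  · exact h2.time_lt.le
  · omega

theorem phase_eq_one {t : ℕ} (h1 : s ≤ t) (h2 : t < e) : r.phase i s e (.proc i, t) = 1 := by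
  have hob : r.OccursBefore (.proc i, t) (.proc i, e) := .locality _ _ _ h2
  unfold phase
  rw [if_neg, if_pos hob]
  rintro ⟨-, hne, hn⟩
  rcases h1.eq_or_lt with rfl | h1
  · exact hne rfl
  · exact hn (.locality _ _ _ h1)

/-- A node before the end has time at most `e`, and a foreign one is not `⟨i, s⟩`; so only the
influence of the start can keep it out of phase `0`. -/
theorem feedbackLoop_of_phase {b : Agent n} {t : ℕ} (hb : b ≠ .proc i) (hb' : b ≠ .disp i)
    (h : r.phase i s e (b, t) = 1) : r.FeedbackLoop i s e := by
  unfold phase at h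
  split_ifs at h with h1 h2
  on_goal 2 => omega
  refine ⟨b, t, hb, hb', ?_, h2⟩
  by_contra hn
  refine h1 ⟨h2.time_lt.le, ?_, hn⟩
  rintro ⟨⟩
  exact hb rfl

/-- The blocks `[0, e]`, `[e + 1, 2e + 1]` and `[2e + 2, ∞)` of the phases are disjoint, so
simultaneous nodes share their phase and hence their original time. -/
theorem phase_mul_add_inj {θ θ' : Agent n × ℕ}
    (h : r.phase i s e θ * (e + 1) + θ.2 = r.phase i s e θ' * (e + 1) + θ'.2) :
    r.phase i s e θ = r.phase i s e θ' ∧ θ.2 = θ'.2 := by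
  have h1 := r.phase_le_two i s e θ
  have h2 := r.phase_le_two i s e θ'
  have h3 := r.time_le_of_phase_lt i s e (θ := θ)
  have h4 := r.time_le_of_phase_lt i s e (θ := θ')
  generalize r.phase i s e θ = g at *
  generalize r.phase i s e θ' = g' at *
  interval_cases g <;> interval_cases g' <;> omega

/-- The rescheduling that carries out the phases one after the other. -/
noncomputable def isolate : Reordering r where
  pos b t := r.phase i s e (b, t) * (e + 1) + t
  pos_lt h := add_lt_add_of_le_of_lt (Nat.mul_le_mul_right _ (r.phase_le i s e h)) h.time_lt
  time_eq h := (r.phase_mul_add_inj i s e h).2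

theorem isolate_pos (b : Agent n) (t : ℕ) :
    (r.isolate i s e).pos b t = r.phase i s e (b, t) * (e + 1) + t := rfl

theorem isShiftFrom_isolate : (r.isolate i s e).IsShiftFrom (2 * (e + 1)) (e + 1) := by
  intro b t ht
  have h : r.phase i s e (b, t) = 2 := by
    by_contra hne
    have := r.time_le_of_phase_lt i s e (lt_of_le_of_ne (r.phase_le_two i s e (b, t)) hne)
    change t ≤ e at this
    omega
  rw [isolate_pos, h]

/-- The window ends at `2e + 1`, the last moment of the middle block, so every node scheduled in it
has phase `1`. -/
theorem soloBetween_isolate [DecidableEq Var] (hloop : ¬ r.FeedbackLoop i s e) :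
    (r.isolate i s e).run.SoloBetween i (e + 1 + s) (e + 1 + e) := by
  intro T h1 h2 b hb hb'
  by_contra hne
  have ha := (r.isolate i s e).active_of_ne_null hne
  refine hloop (r.feedbackLoop_of_phase i s e hb hb' (t := (r.isolate i s e).front b T) ?_)
  rw [Reordering.Active, isolate_pos] at ha
  have h3 := r.phase_le_two i s e (b, (r.isolate i s e).front b T)
  have h4 := r.time_le_of_phase_lt i s e (θ := (b, (r.isolate i s e).front b T))
  generalize r.phase i s e (b, (r.isolate i s e).front b T) = g at *
  interval_cases g <;> simp only at h4 <;> omega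

end Run

end TSO

theorem mainTheorem2 {n : ℕ} {Var Val Op Intl : Type*} [DecidableEq Var]
    (P : TSO.Protocol n Var Val Op Intl) (r : TSO.Run n Var Val Op Intl)
    (hr : r.IsRunOf P) (hsep : r.BufferReadsSeparate)
    (X : TSO.Operation n Op) (s e : ℕ) (hX : X.OccursBetween r s e)
    (hloop : ¬ r.FeedbackLoop X.proc s e) :
    ∃ (r' : TSO.Run n Var Val Op Intl) (s' e' : ℕ),
      r'.IsRunOf P ∧ r'.BufferReadsSeparate ∧ r'.state 0 = r.state 0 ∧
      (r.PropFair → r'.PropFair) ∧ (r.ProcFair P → r'.ProcFair P) ∧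
      r.LocallyEquivalent r' ∧
      X.OccursBetween r' s' e' ∧ r'.SoloBetween X.proc s' e' := by
  have hshift := r.isShiftFrom_isolate X.proc s e
  refine ⟨(r.isolate X.proc s e).run, e + 1 + s, e + 1 + e,
    (r.isolate X.proc s e).isRunOf_run hr hsep,
    (r.isolate X.proc s e).bufferReadsSeparate_run hr hsep,
    (r.isolate X.proc s e).run_state_zero hr, hshift.propFair hr, hshift.procFair hr,
    (r.isolate X.proc s e).locallyEquivalent_run, ?_, r.soloBetween_isolate X.proc s e hloop⟩
  -- The return takes place at `τ = e - 1`; invocation and return thus both have phase `1` and are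
  -- delayed by exactly `e + 1`.
  obtain ⟨τ, hs, rfl, -⟩ := hX.2.2
  have h := (r.isolate X.proc s (τ + 1)).occursBetween_run hX
  rw [TSO.Run.isolate_pos, TSO.Run.isolate_pos, r.phase_eq_one _ _ _ le_rfl (by omega),
    r.phase_eq_one _ _ _ hs.le (by omega)] at h
  simpa [add_assoc] using h
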